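/- Let $G=(V,E,w)$ be a finite simple undirected graph with $V=\{1,\dots,n\}$ and edge weights $w_{ij}>0$, and let $N(i)$ be the set of neighbours of $i$. On $n$ qubits let $X_i,Y_i,Z_i$ be the Pauli matrices acting on qubit $i$, put $h_{ij}=\tfrac12(I+X_iX_j-Y_iY_j+Z_iZ_j)$ and $H(G)=\sum_{(i,j)\in E}w_{ij}h_{ij}$. For $k\ge 1$ let $\mathcal P_k$ be the set of tensor products of the matrices $I,X,Y,Z$ on $n$ qubits with at most $k$ non-identity factors, and $\mathcal O_k=\mathrm{span}_{\mathbb R}\,\mathcal P_k$. Let $\mathcal M_k$ be the set of real symmetric matrices $\Gamma\in\mathbb R^{\mathcal P_k\times\mathcal P_k}$ such that * $\Gamma\succeq 0$; * $\Gamma(A,B)=\Gamma(A',B')$ whenever $A,B,A',B'\in\mathcal P_k$ and $AB=A'B'$; * $\Gamma(A,B)=-\Gamma(A',B')$ whenever $A,B,A',B'\in\mathcal P_k$ and $AB=-A'B'$; * $\Gamma(A,B)=0$ whenever $A,B\in\mathcal P_k$ and $AB$ is not Hermitian; * $\Gamma(A,A)=1$ for all $A\in\mathcal P_k$. Every $\Gamma\in\mathcal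 M_k$ determines a unique real linear functional $L:\mathcal O_{2k}\to\mathbb R$ with $L(AB)=\Gamma(A,B)$ for all $A,B\in\mathcal P_k$ with $AB\in\mathcal O_{2k}$. The level-$k$ quantum moment-SoS hierarchy is the semidefinite program of maximizing $L(H(G))$ over $\Gamma\in\mathcal M_k$. Let $\Gamma$ be any optimal solution of the level-$2$ program, $L$ its functional, and $$g_{ij}=\frac{-1+L(X_iX_j)-L(Y_iY_j)+L(Z_iZ_j)}{2},\qquad g_{ij}^+=\max\{g_{ij},0\}.$$ Then for every edge $(i,j)\in E$ (in either orientation), $$\sum_{k\in N(i)\setminus\{j\}}g_{ik}^+\le Q(g_{ij}^+),\qquad Q(x)=\begin{cases}1-x,&0\le x\le\frac12,\\[2pt] \frac12\left(\sqrt{3(1-x^2)}-x\right),&\frac12<x\le\frac{\sqrt3}{2},\\[2pt] 0,&x>\frac{\sqrt3}{2}.\end{cases}$$ -/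

import Mathlib

/-- The labels `I, X, Y, Z` of the single-qubit Pauli matrices. -/
inductive PauliLabel where
  | I | X | Y | Z
  deriving DecidableEq

instance instFintypePauliLabel : Fintype PauliLabel where
  elems := {.I, .X, .Y, .Z}
  complete a := by cases a <;> simp

/-- The four Pauli matrices on one qubit. -/
def pauliMatrix : PauliLabel → Matrix (Fin 2) (Fin 2) ℂ
  | .I => !![1, 0; 0, 1]
  | .X => !![0, 1; 1, 0]
  | .Y => !![0, -Complex.I; Complex.I, 0]
  | .Z => !![1, 0; 0, -1]

/-- Operators on `n` qubits, as matrices in the computational basis. -/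
abbrev QubitOp (n : ℕ) := Matrix (Fin n → Fin 2) (Fin n → Fin 2) ℂ

/-- A Pauli string assigns a Pauli label to each of the `n` qubits. -/
abbrev PauliString (n : ℕ) := Fin n → PauliLabel

/-- The number of non-identity terms of a Pauli string. -/
def pauliWeight {n : ℕ} (s : PauliString n) : ℕ :=
  (Finset.univ.filter fun i => s i ≠ PauliLabel.I).card

/-- The operator of a Pauli string: the tensor product of its single-qubit Pauli matrices. -/
def pauliOp {n : ℕ} (s : PauliString n) : QubitOp n :=
  Matrix.of fun a b => ∏ i, pauliMatrix (s i) (a i) (b i)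

/-- The Pauli monomials on `n` qubits with at most `k` non-identity terms. -/
abbrev PauliMonomial (n k : ℕ) := {s : PauliString n // pauliWeight s ≤ k}

/-- The real span of the Pauli monomials with at most `k` non-identity terms. -/
noncomputable abbrev pauliSpan (n k : ℕ) : Submodule ℝ (QubitOp n) :=
  Submodule.span ℝ (Set.range fun A : PauliMonomial n k => pauliOp A.1)

/-- Level-`k` moment matrices: real symmetric positive semidefinite matrices indexed by the
Pauli monomials of weight at most `k`, subject to the linear constraints of the quantum
moment-SoS hierarchy. (`Matrix.PosSemidef` includes symmetry.) -/
structure IsMomentMatrix {n k : ℕ}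
    (Γ : Matrix (PauliMonomial n k) (PauliMonomial n k) ℝ) : Prop where
  posSemidef : Γ.PosSemidef
  eq_of_mul_eq : ∀ A B A' B' : PauliMonomial n k,
    pauliOp A.1 * pauliOp B.1 = pauliOp A'.1 * pauliOp B'.1 → Γ A B = Γ A' B'
  eq_neg_of_mul_eq_neg : ∀ A B A' B' : PauliMonomial n k,
    pauliOp A.1 * pauliOp B.1 = -(pauliOp A'.1 * pauliOp B'.1) → Γ A B = -Γ A' B'
  eq_zero_of_not_isHermitian : ∀ A B : PauliMonomial n k,
    ¬ (pauliOp A.1 * pauliOp B.1).IsHermitian → Γ A B = 0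
  diag_eq_one : ∀ A : PauliMonomial n k, Γ A A = 1

/-- The set of level-`k` moment matrices on `n` qubits, as a type. -/
abbrev MomentMatrix (n k : ℕ) :=
  {Γ : Matrix (PauliMonomial n k) (PauliMonomial n k) ℝ // IsMomentMatrix Γ}

/-! Multiplication of Pauli strings, used to show that pseudo-expectations are well defined. -/

/-- The product of two Pauli labels, up to phase. -/
def labelMul : PauliLabel → PauliLabel → PauliLabel
  | .I, b => b
  | a, .I => a
  | .X, .X => .I
  | .X, .Y => .Z
  | .X, .Z => .Y
  | .Y, .X => .Z
  | .Y, .Y => .I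
  | .Y, .Z => .X
  | .Z, .X => .Y
  | .Z, .Y => .X
  | .Z, .Z => .I

/-- The phase of the product of two Pauli labels. -/
noncomputable def labelPhase : PauliLabel → PauliLabel → ℂ
  | .X, .Y => Complex.I
  | .Y, .Z => Complex.I
  | .Z, .X => Complex.I
  | .Y, .X => -Complex.I
  | .Z, .Y => -Complex.I
  | .X, .Z => -Complex.I
  | _, _ => 1

theorem pauliMatrix_mul (a b : PauliLabel) :
    pauliMatrix a * pauliMatrix b = labelPhase a b • pauliMatrix (labelMul a b) := by
  cases a <;> cases b <;> ext i j <;> fin_cases i <;> fin_cases j <;>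
    simp [pauliMatrix, labelPhase, labelMul]

theorem trace_pauliMatrix (a : PauliLabel) :
    (pauliMatrix a).trace = if a = PauliLabel.I then 2 else 0 := by
  cases a <;> simp [pauliMatrix, Matrix.trace_fin_two] <;> norm_num

theorem labelMul_eq_I (a b : PauliLabel) : labelMul a b = PauliLabel.I ↔ a = b := by
  cases a <;> cases b <;> simp [labelMul]

theorem labelMul_comm (a b : PauliLabel) : labelMul a b = labelMul b a := by
  cases a <;> cases b <;> rfl

theorem labelPhase_self (a : PauliLabel) : labelPhase a a = 1 := by
  cases a <;> rfl

theorem labelPhase_I_left (a : PauliLabel) : labelPhase .I a = 1 := by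
  cases a <;> rfl

theorem labelPhase_I_right (a : PauliLabel) : labelPhase a .I = 1 := by
  cases a <;> rfl

theorem labelMul_I_left (a : PauliLabel) : labelMul .I a = a := by
  cases a <;> rfl

theorem labelMul_I_right (a : PauliLabel) : labelMul a .I = a := by
  cases a <;> rfl

theorem labelPhase_mem (a b : PauliLabel) : labelPhase a b ^ 4 = 1 := by
  cases a <;> cases b <;> simp [labelPhase, Complex.I_pow_four, Even.neg_pow (by decide : Even 4)]

theorem pauliOp_mul {n : ℕ} (s t : PauliString n) :
    pauliOp s * pauliOp t =
      (∏ i, labelPhase (s i) (t i)) • pauliOp (fun i => labelMul (s i) (t i)) := by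
  ext a b
  simp only [pauliOp, Matrix.mul_apply, Matrix.of_apply, Matrix.smul_apply, smul_eq_mul,
    ← Finset.prod_mul_distrib]
  rw [← Fintype.piFinset_univ, ← Finset.prod_univ_sum (fun _ => Finset.univ)
    (fun i c => pauliMatrix (s i) (a i) c * pauliMatrix (t i) c (b i))]
  refine Finset.prod_congr rfl fun i _ => ?_
  have h := congrFun (congrFun (pauliMatrix_mul (s i) (t i)) (a i)) (b i)
  simpa [Matrix.mul_apply] using h

theorem trace_pauliOp {n : ℕ} (s : PauliString n) :
    (pauliOp s).trace = ∏ i, (pauliMatrix (s i)).trace := by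
  simp only [pauliOp, Matrix.trace, Matrix.diag, Matrix.of_apply]
  rw [← Fintype.piFinset_univ, ← Finset.prod_univ_sum (fun _ => Finset.univ)
    (fun i c => pauliMatrix (s i) c c)]

theorem trace_pauliOp_mul {n : ℕ} (s t : PauliString n) :
    (pauliOp s * pauliOp t).trace = if s = t then 2 ^ n else 0 := by
  rw [pauliOp_mul, Matrix.trace_smul, trace_pauliOp]
  split_ifs with h
  · subst h
    simp [labelPhase_self, trace_pauliMatrix, (labelMul_eq_I _ _).2 rfl]
  · obtain ⟨i, hi⟩ := Function.ne_iff.1 h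
    have : (∏ i, (pauliMatrix (labelMul (s i) (t i))).trace) = 0 :=
      Finset.prod_eq_zero (Finset.mem_univ i) (by
        rw [trace_pauliMatrix, if_neg]
        exact fun h' => hi ((labelMul_eq_I _ _).1 h'))
    rw [this, smul_zero]

theorem pauliOp_ne_zero {n : ℕ} (s : PauliString n) : pauliOp s ≠ 0 := by
  intro h
  have := trace_pauliOp_mul s s
  rw [h, if_pos rfl, Matrix.mul_zero, Matrix.trace_zero] at this
  exact pow_ne_zero n two_ne_zero this.symm

theorem pauliOp_linearIndependent (n k : ℕ) :
    LinearIndependent ℝ (fun A : PauliMonomial n k => pauliOp A.1) := by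
  rw [Fintype.linearIndependent_iff]
  intro c hc B
  have h := congrArg (fun M => (M * pauliOp B.1).trace) hc
  simp only [Finset.sum_mul, Matrix.trace_sum, smul_mul_assoc, Matrix.trace_smul,
    trace_pauliOp_mul, Subtype.val_inj, zero_mul, Matrix.trace_zero] at h
  simpa using h

theorem pauliOp_isHermitian {n : ℕ} (s : PauliString n) : (pauliOp s).IsHermitian := by
  ext a b
  simp only [pauliOp, Matrix.conjTranspose_apply, Matrix.of_apply, star_prod]
  refine Finset.prod_congr rfl fun i _ => ?_
  generalize s i = σ, a i = p, b i = q
  cases σ <;> fin_cases p <;> fin_cases q <;> simp [pauliMatrix]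

theorem isHermitian_of_mem_pauliSpan {n k : ℕ} {C : QubitOp n} (h : C ∈ pauliSpan n k) :
    C.IsHermitian := by
  induction h using Submodule.span_induction with
  | mem x hx => obtain ⟨A, rfl⟩ := hx; exact pauliOp_isHermitian _
  | zero => exact Matrix.isHermitian_zero
  | add x y _ _ hx hy => exact hx.add hy
  | smul r x _ hx =>
    unfold Matrix.IsHermitian at *
    rw [Matrix.conjTranspose_smul, hx, star_trivial]

theorem pauliOp_mem_pauliSpan {n k : ℕ} (s : PauliString n) (h : pauliWeight s ≤ k) :
    pauliOp s ∈ pauliSpan n k :=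
  Submodule.subset_span ⟨⟨s, h⟩, rfl⟩

theorem pauliWeight_labelMul_le {n : ℕ} (s t : PauliString n) :
    pauliWeight (fun i => labelMul (s i) (t i)) ≤ pauliWeight s + pauliWeight t := by
  classical
  unfold pauliWeight
  refine le_trans (Finset.card_le_card ?_) (Finset.card_union_le _ _)
  intro i
  simp only [Finset.mem_filter, Finset.mem_univ, true_and, Finset.mem_union]
  intro h
  by_contra! h'
  exact h (by rw [h'.1, h'.2]; rfl)

/-- Every Pauli monomial of weight at most `2k` is a product of two of weight at most `k`. -/
theorem exists_pauliOp_mul_eq {n k : ℕ} (P : PauliMonomial n (2 * k)) :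
    ∃ A B : PauliMonomial n k, pauliOp A.1 * pauliOp B.1 = pauliOp P.1 := by
  classical
  obtain ⟨s, hs⟩ := P
  set S := Finset.univ.filter fun i => s i ≠ PauliLabel.I with hS
  obtain ⟨T, hTS, hT⟩ := Finset.exists_subset_card_eq (s := S) (n := min k S.card)
    (min_le_right _ _)
  have hcard : S.card ≤ 2 * k := hs
  refine ⟨⟨fun i => if i ∈ T then s i else .I, ?_⟩, ⟨fun i => if i ∈ T then .I else s i, ?_⟩, ?_⟩
  · refine le_trans (Finset.card_le_card (t := T) ?_) (hT ▸ min_le_left _ _)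
    intro i
    simp
    tauto
  · have hsub : (Finset.univ.filter fun i => (if i ∈ T then PauliLabel.I else s i) ≠ .I) ⊆
        S \ T := by
      intro i
      simp [hS]
      tauto
    refine le_trans (Finset.card_le_card hsub) ?_
    rw [Finset.card_sdiff_of_subset hTS, hT]
    omega
  · rw [pauliOp_mul]
    have h1 : ∀ i, labelPhase (if i ∈ T then s i else .I) (if i ∈ T then .I else s i) = 1 := by
      intro i
      split_ifs
      · exact labelPhase_I_right _
      · exact labelPhase_I_left _
    have h2 : ∀ i, labelMul (if i ∈ T then s i else .I) (if i ∈ T then .I else s i) = s i := by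
      intro i
      split_ifs
      · exact labelMul_I_right _
      · exact labelMul_I_left _
    simp only [h1, h2, Finset.prod_const_one, one_smul]

/-- The constraints on a moment matrix `Γ` determine a real linear functional `L` on the span of
the Pauli monomials of weight at most `2k` with `L (A B) = Γ(A, B)`. -/
theorem existsUnique_pseudoExpectation {n k : ℕ} (Γ : MomentMatrix n k) :
    ∃! L : pauliSpan n (2 * k) →ₗ[ℝ] ℝ, ∀ (A B : PauliMonomial n k)
      (h : pauliOp A.1 * pauliOp B.1 ∈ pauliSpan n (2 * k)),
      L ⟨pauliOp A.1 * pauliOp B.1, h⟩ = Γ.1 A B := by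
  classical
  choose F F' hF using fun P : PauliMonomial n (2 * k) => exists_pauliOp_mul_eq P
  obtain ⟨b, hb⟩ : ∃ b : Module.Basis (PauliMonomial n (2 * k)) ℝ (pauliSpan n (2 * k)),
      ∀ P, (b P : QubitOp n) = pauliOp P.1 :=
    ⟨Module.Basis.span (pauliOp_linearIndependent n (2 * k)), fun P => congrArg Subtype.val
      (Module.Basis.span_apply (pauliOp_linearIndependent n (2 * k)) P)⟩
  obtain ⟨L, hL⟩ : ∃ L : pauliSpan n (2 * k) →ₗ[ℝ] ℝ, ∀ P, L (b P) = Γ.1 (F P) (F' P) :=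
    ⟨b.constr ℝ fun P => Γ.1 (F P) (F' P), fun P => b.constr_basis ℝ _ P⟩
  refine ⟨L, ?_, ?_⟩
  · intro A B h
    set c : ℂ := ∏ i, labelPhase (A.1 i) (B.1 i) with hc
    let P : PauliMonomial n (2 * k) := ⟨fun i => labelMul (A.1 i) (B.1 i),
      (pauliWeight_labelMul_le A.1 B.1).trans (by have := A.2; have := B.2; omega)⟩
    have hAB : pauliOp A.1 * pauliOp B.1 = c • pauliOp P.1 := pauliOp_mul A.1 B.1
    have hc4 : c ^ 4 = 1 := by
      rw [hc, ← Finset.prod_pow]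
      exact Finset.prod_eq_one fun i _ => labelPhase_mem _ _
    have hcreal : star c = c := by
      have hH := isHermitian_of_mem_pauliSpan h
      rw [hAB, Matrix.IsHermitian, Matrix.conjTranspose_smul, (pauliOp_isHermitian P.1).eq] at hH
      exact smul_left_injective ℂ (pauliOp_ne_zero P.1) hH
    have hc1 : c = 1 ∨ c = -1 := by
      obtain ⟨r, hr⟩ := Complex.conj_eq_iff_real.1 hcreal
      rw [hr] at hc4 ⊢
      have h4 : r ^ 4 = 1 := by exact_mod_cast hc4
      have h2 : (r - 1) * (r + 1) = 0 := by
        have : (r ^ 2 + 1) * ((r - 1) * (r + 1)) = 0 := by linear_combination h4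
        rcases mul_eq_zero.1 this with h | h
        · nlinarith [sq_nonneg r]
        · exact h
      rcases mul_eq_zero.1 h2 with h | h
      · left; exact_mod_cast (sub_eq_zero.1 h)
      · right; exact_mod_cast (eq_neg_of_add_eq_zero_left h)
    rcases hc1 with h1 | h1
    · have e : (⟨pauliOp A.1 * pauliOp B.1, h⟩ : pauliSpan n (2 * k)) = b P :=
        Subtype.ext (by simp only [hb, hAB, h1, one_smul])
      rw [e, hL]
      exact Γ.2.eq_of_mul_eq _ _ _ _ (by rw [hF, hAB, h1, one_smul])
    · have e : (⟨pauliOp A.1 * pauliOp B.1, h⟩ : pauliSpan n (2 * k)) = -b P :=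
        Subtype.ext (by simp only [Submodule.coe_neg, hb, hAB, h1, neg_smul, one_smul])
      rw [e, map_neg, hL]
      exact (Γ.2.eq_neg_of_mul_eq_neg _ _ _ _ (by
        rw [hF, hAB, h1, neg_smul, one_smul])).symm
  · intro L' hL'
    refine b.ext fun P => ?_
    have h : pauliOp (F P).1 * pauliOp (F' P).1 ∈ pauliSpan n (2 * k) := by
      rw [hF]; exact pauliOp_mem_pauliSpan P.1 P.2
    have e : b P = ⟨pauliOp (F P).1 * pauliOp (F' P).1, h⟩ :=
      Subtype.ext (by simp only [hb, hF])
    rw [hL, e, hL']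

/-- The pseudo-expectation of a level-`k` moment matrix `Γ`: the real linear functional `L` on the
span of the Pauli monomials of weight at most `2k` with `L C = Γ(A, B)` whenever `C = A B`. -/
noncomputable def pseudoExpectation {n k : ℕ} (Γ : MomentMatrix n k) :
    pauliSpan n (2 * k) →ₗ[ℝ] ℝ :=
  (existsUnique_pseudoExpectation Γ).choose

theorem pseudoExpectation_mul {n k : ℕ} (Γ : MomentMatrix n k) (A B : PauliMonomial n k)
    (h : pauliOp A.1 * pauliOp B.1 ∈ pauliSpan n (2 * k)) :
    pseudoExpectation Γ ⟨pauliOp A.1 * pauliOp B.1, h⟩ = Γ.1 A B :=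
  (existsUnique_pseudoExpectation Γ).choose_spec.1 A B h

/-- The Pauli matrix `σ` acting on qubit `i` (and the identity on all other qubits). -/
def siteOp {n : ℕ} (σ : PauliLabel) (i : Fin n) : QubitOp n :=
  pauliOp (Function.update (fun _ => PauliLabel.I) i σ)

theorem siteOp_mul {n : ℕ} (σ : PauliLabel) (i j : Fin n) :
    siteOp σ i * siteOp σ j =
      pauliOp (fun l => labelMul (Function.update (fun _ => PauliLabel.I) i σ l)
        (Function.update (fun _ => PauliLabel.I) j σ l)) := by
  rw [siteOp, siteOp, pauliOp_mul, Finset.prod_eq_one, one_smul]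
  intro l _
  simp only [Function.update_apply]
  split_ifs <;> simp [labelPhase_self, labelPhase_I_left, labelPhase_I_right]

theorem siteOp_mul_comm {n : ℕ} (σ : PauliLabel) (i j : Fin n) :
    siteOp σ i * siteOp σ j = siteOp σ j * siteOp σ i := by
  rw [siteOp_mul, siteOp_mul]
  simp only [labelMul_comm]

theorem pauliWeight_update_le {n : ℕ} (σ : PauliLabel) (i : Fin n) :
    pauliWeight (Function.update (fun _ => PauliLabel.I) i σ) ≤ 1 := by
  unfold pauliWeight
  refine le_trans (Finset.card_le_card (t := {i}) ?_) (by simp)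
  intro l
  simp only [Finset.mem_filter, Finset.mem_univ, true_and, Finset.mem_singleton,
    Function.update_apply]
  split_ifs <;> simp_all

theorem siteOp_mul_mem {n m : ℕ} (hm : 2 ≤ m) (σ : PauliLabel) (i j : Fin n) :
    siteOp σ i * siteOp σ j ∈ pauliSpan n m := by
  rw [siteOp_mul]
  refine pauliOp_mem_pauliSpan _ ((pauliWeight_labelMul_le _ _).trans ?_)
  have := pauliWeight_update_le σ i
  have := pauliWeight_update_le σ j
  omega

theorem one_mem_pauliSpan (n m : ℕ) : (1 : QubitOp n) ∈ pauliSpan n m := by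
  have h : pauliOp (fun _ : Fin n => PauliLabel.I) = 1 := by
    ext a b
    simp only [pauliOp, Matrix.of_apply, Matrix.one_apply]
    split_ifs with hab
    · subst hab
      refine Finset.prod_eq_one fun i _ => ?_
      generalize a i = p
      fin_cases p <;> simp [pauliMatrix]
    · obtain ⟨i, hi⟩ := Function.ne_iff.1 hab
      refine Finset.prod_eq_zero (Finset.mem_univ i) ?_
      revert hi
      generalize a i = p, b i = q
      fin_cases p <;> fin_cases q <;> simp [pauliMatrix]
  rw [← h]
  exact pauliOp_mem_pauliSpan _ (by simp [pauliWeight])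

/-- The EPR term `h_ij = (I + X_i X_j - Y_i Y_j + Z_i Z_j) / 2` on the pair of qubits `i, j`. -/
noncomputable def eprTerm {n : ℕ} (i j : Fin n) : QubitOp n :=
  (1 / 2 : ℝ) • (1 + siteOp .X i * siteOp .X j - siteOp .Y i * siteOp .Y j
    + siteOp .Z i * siteOp .Z j)

theorem eprTerm_comm {n : ℕ} (i j : Fin n) : eprTerm i j = eprTerm j i := by
  rw [eprTerm, eprTerm, siteOp_mul_comm .X, siteOp_mul_comm .Y, siteOp_mul_comm .Z]

theorem eprTerm_mem {n m : ℕ} (hm : 2 ≤ m) (i j : Fin n) : eprTerm i j ∈ pauliSpan n m :=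
  Submodule.smul_mem _ _ (Submodule.add_mem _ (Submodule.sub_mem _ (Submodule.add_mem _
    (one_mem_pauliSpan n m) (siteOp_mul_mem hm .X i j)) (siteOp_mul_mem hm .Y i j))
    (siteOp_mul_mem hm .Z i j))

/-- The EPR Hamiltonian `H(G) = ∑_{(i,j) ∈ E} w_ij h_ij` of a weighted graph; each undirected edge
is counted once. -/
noncomputable def eprHamiltonian {n : ℕ} (G : SimpleGraph (Fin n)) [DecidableRel G.Adj]
    (w : G.edgeSet → ℝ) : QubitOp n :=
  ∑ e : G.edgeSet, w e • Sym2.lift ⟨eprTerm, eprTerm_comm⟩ e.1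

theorem eprHamiltonian_mem {n m : ℕ} (hm : 2 ≤ m) (G : SimpleGraph (Fin n)) [DecidableRel G.Adj]
    (w : G.edgeSet → ℝ) : eprHamiltonian G w ∈ pauliSpan n m := by
  refine Submodule.sum_mem _ fun e _ => Submodule.smul_mem _ _ ?_
  obtain ⟨e, he⟩ := e
  induction e with
  | _ i j => exact eprTerm_mem hm i j

theorem two_le_two_mul {k : ℕ} (hk : 1 ≤ k) : 2 ≤ 2 * k := by omega

/-- The objective `L(H(G))` of the level-`k` semidefinite program at the moment matrix `Γ`. -/
noncomputable def sdpObjective {n k : ℕ} (hk : 1 ≤ k) (G : SimpleGraph (Fin n))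
    [DecidableRel G.Adj] (w : G.edgeSet → ℝ) (Γ : MomentMatrix n k) : ℝ :=
  pseudoExpectation Γ ⟨eprHamiltonian G w, eprHamiltonian_mem (two_le_two_mul hk) G w⟩

/-- `Γ` is an output of the level-`k` quantum moment-SoS hierarchy for the EPR problem on `(G, w)`:
it maximizes `L(H(G))` over all level-`k` moment matrices. -/
def IsSDPOutput {n k : ℕ} (hk : 1 ≤ k) (G : SimpleGraph (Fin n))
    [DecidableRel G.Adj] (w : G.edgeSet → ℝ) (Γ : MomentMatrix n k) : Prop :=
  ∀ Γ' : MomentMatrix n k, sdpObjective hk G w Γ' ≤ sdpObjective hk G w Γ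

/-- The pseudo-expectation `L(σ_i σ_j)` of a two-qubit Pauli correlation. -/
noncomputable def pauliCorrelation {n k : ℕ} (hk : 1 ≤ k) (Γ : MomentMatrix n k)
    (σ : PauliLabel) (i j : Fin n) : ℝ :=
  pseudoExpectation Γ ⟨siteOp σ i * siteOp σ j, siteOp_mul_mem (two_le_two_mul hk) σ i j⟩

/-- The edge value `g_ij = (-1 + L(X_i X_j) - L(Y_i Y_j) + L(Z_i Z_j)) / 2`. -/
noncomputable def edgeValue {n k : ℕ} (hk : 1 ≤ k) (Γ : MomentMatrix n k) (i j : Fin n) : ℝ :=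
  (-1 + pauliCorrelation hk Γ .X i j - pauliCorrelation hk Γ .Y i j
    + pauliCorrelation hk Γ .Z i j) / 2

/-- The positive part `g_ij⁺ = max {g_ij, 0}` of the edge value. -/
noncomputable def edgeValuePos {n k : ℕ} (hk : 1 ≤ k) (Γ : MomentMatrix n k) (i j : Fin n) : ℝ :=
  max (edgeValue hk Γ i j) 0

/-- The bound `Q` on `[0, 1]`: `1 - x` on `[0, 1/2]`, `(√(3 (1 - x²)) - x) / 2` on
`(1/2, √3/2]`, and `0` on `(√3/2, 1]`. -/
noncomputable def moeBound (x : ℝ) : ℝ :=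
  if x ≤ 1 / 2 then 1 - x
  else if x ≤ Real.sqrt 3 / 2 then (Real.sqrt (3 * (1 - x ^ 2)) - x) / 2
  else 0

/-!
Conjugating qubit `i` by `Y` turns `1 - h_il` into the swap `s_il` of the qubits `i` and `l`, so
that `g_il = -L(s_il)`. The swaps satisfy `s_il² = 1`, and, because three qubits carry no
antisymmetric tensor, `s_ij s_il + s_il s_ij = s_ij + s_il + s_jl - 1`. Bounding `L(s_jl)` by `1`
therefore bounds every second moment of the `s_il` by their means.

For a set `T` of `d` qubits other than `i`, nonnegativity of the variance of `∑_{l ∈ T} s_il` gives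
`∑_{l ∈ T} g_il ≤ 1`, which is the bound `Q(x) = 1 - x`. For `x = g_ij > 1/2` and
`y = ∑_{l ∈ S} g_il`, where `S` consists of `d` further qubits with `g_il ≥ 0`, the bound by `Q` is
the inequality `x² + xy + y² ≤ 3/4`. When `d ≥ 2` it follows from the Cauchy-Schwarz inequality for
the covariance of `s_ij` and `∑_{l ∈ S} s_il`. When `d = 1` that is too weak, and one works on the
complement of the symmetric tensors of the three qubits, where the swaps act as reflections of a
plane in axes whose Bloch vectors form angles of 120 degrees.
-/

section PseudoState

variable {R : Type*} [Ring R] [Algebra ℝ R]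

/-- A pseudo-state on a real algebra: a normalized real linear functional that is nonnegative on
the squares of the elements of a subspace `V` containing `1`. It abstracts the positivity of a
moment matrix whose rows are indexed by a basis of `V`. -/
structure IsPseudoState (V : Submodule ℝ R) (L : R →ₗ[ℝ] ℝ) : Prop where
  one_mem : 1 ∈ V
  map_one : L 1 = 1
  map_mul_self_nonneg : ∀ a ∈ V, 0 ≤ L (a * a)

namespace IsPseudoState

variable {V : Submodule ℝ R} {L : R →ₗ[ℝ] ℝ} {a b : R}

theorem sq_map_anticommutator_le (hL : IsPseudoState V L) (ha : a ∈ V) (hb : b ∈ V) :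
    L (a * b + b * a) ^ 2 ≤ 4 * L (a * a) * L (b * b) := by
  have hquad (t : ℝ) : 0 ≤ L (a * a) * (t * t) + L (a * b + b * a) * t + L (b * b) := by
    have hexpand : (t • a + b) * (t • a + b) = (t * t) • (a * a) + t • (a * b + b * a) + b * b := by
      simp only [add_mul, mul_add, smul_mul_assoc, mul_smul_comm]
      module
    have hnonneg := hL.map_mul_self_nonneg _ (V.add_mem (V.smul_mem t ha) hb)
    rw [hexpand, map_add, map_add, map_smul, map_smul, smul_eq_mul, smul_eq_mul] at hnonneg
    linarith
  have hdiscrim := discrim_le_zero hquad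
  rw [discrim] at hdiscrim
  linarith

theorem sq_map_le (hL : IsPseudoState V L) (ha : a ∈ V) : L a ^ 2 ≤ L (a * a) := by
  have h := hL.sq_map_anticommutator_le ha hL.one_mem
  rw [mul_one, one_mul, mul_one, map_add, hL.map_one] at h
  linarith

theorem map_le_one_of_mul_self_eq_one (hL : IsPseudoState V L) (ha : a ∈ V) (haa : a * a = 1) :
    L a ≤ 1 := by
  have h := hL.sq_map_le ha
  rw [haa, hL.map_one] at h
  exact (abs_le.1 ((sq_le_one_iff_abs_le_one _).1 h)).2

theorem map_center_mul_center (hL : IsPseudoState V L) (a b : R) :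
    L ((a - L a • 1) * (b - L b • 1)) = L (a * b) - L a * L b := by
  simp only [sub_mul, mul_sub, smul_mul_assoc, mul_smul_comm, one_mul, mul_one, map_sub, map_smul,
    hL.map_one, smul_eq_mul]
  ring

theorem sq_covariance_le (hL : IsPseudoState V L) (ha : a ∈ V) (hb : b ∈ V) :
    (L (a * b + b * a) - 2 * (L a * L b)) ^ 2 ≤
      4 * (L (a * a) - L a ^ 2) * (L (b * b) - L b ^ 2) := by
  have hcenter {c : R} (hc : c ∈ V) : c - L c • 1 ∈ V :=
    V.sub_mem hc (V.smul_mem _ hL.one_mem)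
  have h := hL.sq_map_anticommutator_le (hcenter ha) (hcenter hb)
  simp only [map_add, hL.map_center_mul_center] at h ⊢
  linarith

/-- The elements `a` and `b` play the role of two reflections of a plane in axes whose Bloch vectors
form an angle of 120 degrees, and `e` that of the identity of the plane. The bound is the
Cauchy-Schwarz inequality for `e` and the combination of `a` and `b` with the largest expectation
for its square. -/
theorem sq_add_mul_add_sq_le_of_reflections (hL : IsPseudoState V L) {e : R} (he : e ∈ V)
    (ha : a ∈ V) (hb : b ∈ V) (hee : e * e = e) (haa : a * a = e) (hbb : b * b = e)
    (hab : a * b + b * a = -e) (hea : e * a + a * e = (2 : ℝ) • a)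
    (heb : e * b + b * e = (2 : ℝ) • b) :
    L a ^ 2 + L a * L b + L b ^ 2 ≤ 3 / 4 * L e ^ 2 := by
  set K := L a ^ 2 + L a * L b + L b ^ 2 with hK
  let m := (2 * L a + L b) • a + (L a + 2 * L b) • b
  have hm : m ∈ V := V.add_mem (V.smul_mem _ ha) (V.smul_mem _ hb)
  have hem : e * m + m * e = (2 : ℝ) • m := by
    simp only [m, mul_add, add_mul, smul_mul_assoc, mul_smul_comm]
    linear_combination (norm := module) (2 * L a + L b) • hea + (L a + 2 * L b) • heb
  have hmm : m * m = (3 * K) • e := by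
    simp only [m, hK, mul_add, add_mul, smul_mul_assoc, mul_smul_comm]
    linear_combination (norm := module) (2 * L a + L b) ^ 2 • haa +
      (L a + 2 * L b) ^ 2 • hbb + ((2 * L a + L b) * (L a + 2 * L b)) • hab
  have hLm : L m = 2 * K := by
    simp only [m, hK, map_add, map_smul, smul_eq_mul]
    ring
  have hcs := hL.sq_map_anticommutator_le he hm
  rw [hem, hmm, hee, map_smul, map_smul, hLm, smul_eq_mul, smul_eq_mul] at hcs
  by_contra! hlt
  nlinarith [lt_of_le_of_lt (by positivity) hlt]

end IsPseudoState

end PseudoState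

section SwapTriangle

variable {R : Type*} [Ring R]

/-- The Jordan-algebra relations between the three transpositions `a`, `b`, `c` of three qubits.
The anticommutator relations hold because there is no antisymmetric tensor on three qubits, so that
`1 - a - b - c + a * b + b * a = 0`. -/
structure IsSwapTriangle (a b c : R) : Prop where
  mul_self_left : a * a = 1
  mul_self_mid : b * b = 1
  mul_self_right : c * c = 1
  anticomm_left_mid : a * b + b * a = a + b + c - 1
  anticomm_left_right : a * c + c * a = a + b + c - 1
  anticomm_mid_right : b * c + c * b = a + b + c - 1

theorem IsSwapTriangle.swap {a b c : R} (h : IsSwapTriangle a b c) : IsSwapTriangle b a c where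
  mul_self_left := h.mul_self_mid
  mul_self_mid := h.mul_self_left
  mul_self_right := h.mul_self_right
  anticomm_left_mid := by rw [add_comm, h.anticomm_left_mid, add_comm a]
  anticomm_left_right := by rw [h.anticomm_mid_right, add_comm a]
  anticomm_mid_right := by rw [h.anticomm_left_right, add_comm a]

variable [Algebra ℝ R]

/-- The mean of the three transpositions of three qubits, which is the projection onto the
symmetric tensors. -/
noncomputable def symmetrizer (a b c : R) : R :=
  (1 / 3 : ℝ) • (a + b + c)

theorem symmetrizer_swap (a b c : R) : symmetrizer b a c = symmetrizer a b c := by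
  rw [symmetrizer, symmetrizer, add_comm b]

theorem symmetrizer_mem {V : Submodule ℝ R} {a b c : R} (ha : a ∈ V) (hb : b ∈ V) (hc : c ∈ V) :
    symmetrizer a b c ∈ V :=
  V.smul_mem _ (V.add_mem (V.add_mem ha hb) hc)

namespace IsSwapTriangle

variable {a b c : R} {V : Submodule ℝ R} {L : R →ₗ[ℝ] ℝ}

theorem symmetrizer_mul_self (h : IsSwapTriangle a b c) :
    symmetrizer a b c * symmetrizer a b c = symmetrizer a b c := by
  simp only [symmetrizer, add_mul, mul_add, smul_mul_assoc, mul_smul_comm]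
  linear_combination (norm := module) (1 / 9 : ℝ) • (h.mul_self_left + h.mul_self_mid +
    h.mul_self_right + h.anticomm_left_mid + h.anticomm_left_right + h.anticomm_mid_right)

theorem one_sub_symmetrizer_mul_self (h : IsSwapTriangle a b c) :
    (1 - symmetrizer a b c) * (1 - symmetrizer a b c) = 1 - symmetrizer a b c :=
  IsIdempotentElem.one_sub h.symmetrizer_mul_self

theorem anticomm_symmetrizer (h : IsSwapTriangle a b c) :
    a * symmetrizer a b c + symmetrizer a b c * a = (2 : ℝ) • symmetrizer a b c := by
  simp only [symmetrizer, mul_add, add_mul, smul_mul_assoc, mul_smul_comm]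
  linear_combination (norm := module) (1 / 3 : ℝ) • ((2 : ℝ) • h.mul_self_left +
    h.anticomm_left_mid + h.anticomm_left_right)

theorem sub_symmetrizer_mul_self (h : IsSwapTriangle a b c) :
    (a - symmetrizer a b c) * (a - symmetrizer a b c) = 1 - symmetrizer a b c := by
  rw [sub_mul, mul_sub, mul_sub]
  linear_combination (norm := module)
    h.mul_self_left - h.anticomm_symmetrizer + h.symmetrizer_mul_self

theorem anticomm_sub_symmetrizer (h : IsSwapTriangle a b c) :
    (a - symmetrizer a b c) * (b - symmetrizer a b c) +
      (b - symmetrizer a b c) * (a - symmetrizer a b c) = -(1 - symmetrizer a b c) := by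
  have hsum : a + b + c = (3 : ℝ) • symmetrizer a b c := by
    rw [symmetrizer]
    module
  have hb := h.swap.anticomm_symmetrizer
  rw [symmetrizer_swap] at hb
  simp only [sub_mul, mul_sub]
  linear_combination (norm := module) h.anticomm_left_mid + hsum - h.anticomm_symmetrizer - hb +
    (2 : ℝ) • h.symmetrizer_mul_self

theorem anticomm_one_sub_symmetrizer (h : IsSwapTriangle a b c) :
    (1 - symmetrizer a b c) * (a - symmetrizer a b c) +
      (a - symmetrizer a b c) * (1 - symmetrizer a b c) = (2 : ℝ) • (a - symmetrizer a b c) := by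
  simp only [sub_mul, mul_sub, one_mul, mul_one]
  linear_combination (norm := module)
    (2 : ℝ) • h.symmetrizer_mul_self - h.anticomm_symmetrizer

theorem map_symmetrizer_nonneg (h : IsSwapTriangle a b c) (hL : IsPseudoState V L) (ha : a ∈ V)
    (hb : b ∈ V) (hc : c ∈ V) : 0 ≤ L (symmetrizer a b c) := by
  rw [← h.symmetrizer_mul_self]
  exact hL.map_mul_self_nonneg _ (symmetrizer_mem ha hb hc)

theorem map_sub_symmetrizer_sq_le (h : IsSwapTriangle a b c) (hL : IsPseudoState V L)
    (ha : a ∈ V) (hb : b ∈ V) (hc : c ∈ V) :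
    L (a - symmetrizer a b c) ^ 2 +
      L (a - symmetrizer a b c) * L (b - symmetrizer a b c) + L (b - symmetrizer a b c) ^ 2 ≤
      3 / 4 * L (1 - symmetrizer a b c) ^ 2 := by
  have hp := symmetrizer_mem (V := V) ha hb hc
  have hbb := h.swap.sub_symmetrizer_mul_self
  have heb := h.swap.anticomm_one_sub_symmetrizer
  rw [symmetrizer_swap] at hbb heb
  exact hL.sq_add_mul_add_sq_le_of_reflections (V.sub_mem hL.one_mem hp) (V.sub_mem ha hp)
    (V.sub_mem hb hp) h.one_sub_symmetrizer_mul_self h.sub_symmetrizer_mul_self hbb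
    h.anticomm_sub_symmetrizer h.anticomm_one_sub_symmetrizer heb

theorem sq_add_mul_add_sq_le (h : IsSwapTriangle a b c) (hL : IsPseudoState V L) (ha : a ∈ V)
    (hb : b ∈ V) (hc : c ∈ V) (hLa : L a ≤ 0) (hLb : L b ≤ 0) :
    L a ^ 2 + L a * L b + L b ^ 2 ≤ 3 / 4 := by
  have hquad := h.map_sub_symmetrizer_sq_le hL ha hb hc
  have hp := h.map_symmetrizer_nonneg hL ha hb hc
  simp only [map_sub, hL.map_one] at hquad
  nlinarith [mul_nonneg hp (neg_nonneg.2 hLa), mul_nonneg hp (neg_nonneg.2 hLb)]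

end IsSwapTriangle

end SwapTriangle

section MoeBound

theorem moeBound_nonneg {x : ℝ} (hx : 0 ≤ x) : 0 ≤ moeBound x := by
  unfold moeBound
  split_ifs with hhalf hsqrt
  · linarith
  · have hx_sq : x ^ 2 ≤ 3 / 4 := by
      have h := pow_le_pow_left₀ hx hsqrt 2
      rw [div_pow, Real.sq_sqrt (by norm_num)] at h
      linarith
    have hx_le : x ≤ √(3 * (1 - x ^ 2)) := Real.le_sqrt_of_sq_le (by linarith)
    linarith
  · exact le_rfl

theorem le_moeBound {x y : ℝ} (hx : 1 / 2 < x) (hy : 0 ≤ y)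
    (hxy : x ^ 2 + x * y + y ^ 2 ≤ 3 / 4) : y ≤ moeBound x := by
  rw [moeBound, if_neg (not_le.2 hx)]
  split_ifs with hsqrt
  · have hle : 2 * y + x ≤ √(3 * (1 - x ^ 2)) := Real.le_sqrt_of_sq_le (by linarith)
    linarith
  · refine absurd ?_ hsqrt
    rw [le_div_iff₀ two_pos]
    exact Real.le_sqrt_of_sq_le (by nlinarith)

theorem sq_add_mul_add_sq_le_of_covariance_bound {d x y : ℝ} (hd : 2 ≤ d) (hy : 0 ≤ y)
    (hy' : y ≤ 1 / 2) (hxy : x + y ≤ 1)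
    (h : (x * d + y + 2 * (x * y)) ^ 2 ≤ 4 * (1 - x ^ 2) * ((1 - y) * (d + y))) :
    x ^ 2 + x * y + y ^ 2 ≤ 3 / 4 := by
  by_contra! hlt
  -- The difference of the two sides of `h` is a polynomial in `d - 2` with nonnegative coefficients.
  have hprod : x * y ≤ (1 - y) * y := mul_le_mul_of_nonneg_right (by linarith) hy
  have hslope : 0 ≤ 4 * x ^ 2 + x * y + 2 * y - 2 := by nlinarith
  have hbase : 0 < (x * 2 + y + 2 * (x * y)) ^ 2 - 4 * (1 - x ^ 2) * ((1 - y) * (2 + y)) := by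
    calc 0 < 1 - y + y ^ 2 - 4 * y ^ 3 := by nlinarith [sq_nonneg (1 - 2 * y)]
      _ ≤ 1 + 7 * y - 7 * y ^ 2 - 4 * y ^ 3 - 8 * (x * y) := by linarith
      _ ≤ 1 + 7 * y - 7 * y ^ 2 - 4 * y ^ 3 - 8 * (x * y) +
          (12 + 4 * y) * (x ^ 2 + x * y + y ^ 2 - 3 / 4) :=
        le_add_of_nonneg_right (mul_nonneg (by linarith) (by linarith))
      _ = _ := by ring
  have hd_part : 0 ≤ (d - 2) * (2 * (4 * x ^ 2 + x * y + 2 * y - 2) + x ^ 2 * (d - 2)) :=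
    mul_nonneg (by linarith)
      (add_nonneg (by linarith) (mul_nonneg (sq_nonneg x) (by linarith)))
  linarith

end MoeBound

section SwapFamily

variable {ι R : Type*} [Ring R]

/-- A family of elements satisfying the Jordan-algebra relations of the transpositions of qubits
labelled by `ι`; see `IsSwapTriangle` for the anticommutator relation. The diagonal entries are
irrelevant. -/
structure IsSwapFamily (s : ι → ι → R) : Prop where
  symm : ∀ i j, s i j = s j i
  mul_self : ∀ ⦃i j⦄, i ≠ j → s i j * s i j = 1
  anticomm : ∀ ⦃i j k⦄, i ≠ j → i ≠ k → j ≠ k →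
    s i j * s i k + s i k * s i j = s i j + s i k + s j k - 1

namespace IsSwapFamily

variable {s : ι → ι → R}

theorem isSwapTriangle (hs : IsSwapFamily s) {i j k : ι} (hij : i ≠ j) (hik : i ≠ k)
    (hjk : j ≠ k) : IsSwapTriangle (s i j) (s i k) (s j k) where
  mul_self_left := hs.mul_self hij
  mul_self_mid := hs.mul_self hik
  mul_self_right := hs.mul_self hjk
  anticomm_left_mid := hs.anticomm hij hik hjk
  anticomm_left_right := by
    rw [hs.symm i j, hs.anticomm hij.symm hjk hik]
    abel
  anticomm_mid_right := by
    rw [hs.symm i k, hs.symm j k, hs.anticomm hik.symm hjk.symm hij]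
    abel

variable [Algebra ℝ R] {V : Submodule ℝ R} {L : R →ₗ[ℝ] ℝ}

theorem map_anticommutator_le (hs : IsSwapFamily s) (hL : IsPseudoState V L) {i j k : ι}
    (hij : i ≠ j) (hik : i ≠ k) (hjk : j ≠ k) (hjkV : s j k ∈ V) :
    L (s i j * s i k + s i k * s i j) ≤ L (s i j) + L (s i k) := by
  rw [hs.anticomm hij hik hjk, map_sub, map_add, map_add, hL.map_one]
  linarith [hL.map_le_one_of_mul_self_eq_one hjkV (hs.mul_self hjk)]

theorem map_anticommutator_sum_le (hs : IsSwapFamily s) (hL : IsPseudoState V L)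
    (hsV : ∀ i j, i ≠ j → s i j ∈ V) {i j : ι} {S : Finset ι} (hij : i ≠ j) (hi : i ∉ S)
    (hj : j ∉ S) :
    L (s i j * ∑ k ∈ S, s i k + (∑ k ∈ S, s i k) * s i j) ≤
      S.card * L (s i j) + ∑ k ∈ S, L (s i k) := by
  rw [Finset.mul_sum, Finset.sum_mul, ← Finset.sum_add_distrib, map_sum, ← nsmul_eq_mul,
    ← Finset.sum_const, ← Finset.sum_add_distrib]
  refine Finset.sum_le_sum fun k hk => ?_
  have hjk : j ≠ k := (ne_of_mem_of_not_mem hk hj).symm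
  exact hs.map_anticommutator_le hL hij (ne_of_mem_of_not_mem hk hi).symm hjk (hsV j k hjk)

theorem map_sum_mul_sum_le (hs : IsSwapFamily s) (hL : IsPseudoState V L)
    (hsV : ∀ i j, i ≠ j → s i j ∈ V) {i : ι} {S : Finset ι} (hi : i ∉ S) :
    L ((∑ k ∈ S, s i k) * ∑ k ∈ S, s i k) ≤ S.card + (S.card - 1) * ∑ k ∈ S, L (s i k) := by
  classical
  induction S using Finset.induction_on with
  | empty => simp
  | insert j S hj ih =>
    rw [Finset.mem_insert, not_or] at hi
    have hcross := hs.map_anticommutator_sum_le hL hsV hi.1 hi.2 hj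
    have hexpand (a b : R) : (a + b) * (a + b) = a * a + (a * b + b * a) + b * b := by
      noncomm_ring
    rw [Finset.sum_insert hj, Finset.sum_insert hj, Finset.card_insert_of_notMem hj, hexpand,
      map_add, map_add, hs.mul_self hi.1, hL.map_one]
    push_cast
    linarith [ih hi.2]

theorem sum_neg_map_le_one (hs : IsSwapFamily s) (hL : IsPseudoState V L)
    (hsV : ∀ i j, i ≠ j → s i j ∈ V) {i : ι} {S : Finset ι} (hi : i ∉ S) :
    ∑ k ∈ S, -L (s i k) ≤ 1 := by
  have hsum : ∑ k ∈ S, s i k ∈ V :=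
    V.sum_mem fun k hk => hsV i k (ne_of_mem_of_not_mem hk hi).symm
  have hvar := (hL.sq_map_le hsum).trans (hs.map_sum_mul_sum_le hL hsV hi)
  have hcard : (0 : ℝ) ≤ S.card := Nat.cast_nonneg _
  rw [map_sum] at hvar
  rw [Finset.sum_neg_distrib]
  have hfactor : (-∑ k ∈ S, L (s i k) - 1) * (S.card + -∑ k ∈ S, L (s i k)) ≤ 0 := by linarith
  by_contra! hlt
  exact hfactor.not_gt (mul_pos (by linarith) (by linarith))

theorem covariance_bound (hs : IsSwapFamily s) (hL : IsPseudoState V L)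
    (hsV : ∀ i j, i ≠ j → s i j ∈ V) {i j : ι} {S : Finset ι} (hij : i ≠ j) (hi : i ∉ S)
    (hj : j ∉ S) {x y : ℝ} (hLx : L (s i j) = -x) (hLy : ∑ k ∈ S, L (s i k) = -y)
    (hx : 0 ≤ x) (hy : 0 ≤ y) :
    (x * S.card + y + 2 * (x * y)) ^ 2 ≤ 4 * (1 - x ^ 2) * ((1 - y) * (S.card + y)) := by
  have hsum : ∑ k ∈ S, s i k ∈ V :=
    V.sum_mem fun k hk => hsV i k (ne_of_mem_of_not_mem hk hi).symm
  have hcov := hL.sq_covariance_le (hsV i j hij) hsum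
  have hcross := hs.map_anticommutator_sum_le hL hsV hij hi hj
  have hvar := hs.map_sum_mul_sum_le hL hsV hi
  have hvar_edge := hL.sq_map_le (hsV i j hij)
  rw [hs.mul_self hij, hL.map_one, hLx, neg_sq] at hvar_edge
  rw [hs.mul_self hij, hL.map_one, map_sum, hLx, hLy] at hcov
  rw [hLx, hLy] at hcross
  rw [hLy] at hvar
  generalize (∑ k ∈ S, s i k) = U at *
  calc (x * S.card + y + 2 * (x * y)) ^ 2
      ≤ (-(L (s i j * U + U * s i j) - 2 * (-x * -y))) ^ 2 := by
        refine pow_le_pow_left₀ (by positivity) ?_ 2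
        linarith
    _ = (L (s i j * U + U * s i j) - 2 * (-x * -y)) ^ 2 := neg_sq _
    _ ≤ 4 * (1 - (-x) ^ 2) * (L (U * U) - (-y) ^ 2) := hcov
    _ ≤ 4 * (1 - x ^ 2) * ((1 - y) * (S.card + y)) := by
        rw [neg_sq, neg_sq]
        gcongr
        linarith

theorem sq_add_mul_add_sq_le (hs : IsSwapFamily s) (hL : IsPseudoState V L)
    (hsV : ∀ i j, i ≠ j → s i j ∈ V) {i j : ι} {S : Finset ι} (hij : i ≠ j) (hi : i ∉ S)
    (hj : j ∉ S) (hS : S.Nonempty) {x y : ℝ} (hLx : L (s i j) = -x)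
    (hLy : ∑ k ∈ S, L (s i k) = -y) (hx : 1 / 2 ≤ x) (hy : 0 ≤ y) (hxy : x + y ≤ 1) :
    x ^ 2 + x * y + y ^ 2 ≤ 3 / 4 := by
  rcases hS.card_pos.nat_succ_le.eq_or_lt with hone | htwo
  · obtain ⟨k, rfl⟩ := Finset.card_eq_one.1 hone.symm
    rw [Finset.mem_singleton] at hi hj
    rw [Finset.sum_singleton] at hLy
    have h := (hs.isSwapTriangle hij hi hj).sq_add_mul_add_sq_le hL (hsV i j hij) (hsV i k hi)
      (hsV j k hj) (by linarith) (by linarith)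
    rwa [hLx, hLy, neg_sq, neg_sq, neg_mul_neg] at h
  · exact sq_add_mul_add_sq_le_of_covariance_bound (by exact_mod_cast htwo) hy (by linarith) hxy
      (hs.covariance_bound hL hsV hij hi hj hLx hLy (by linarith) hy)

theorem sum_neg_map_le_moeBound (hs : IsSwapFamily s) (hL : IsPseudoState V L)
    (hsV : ∀ i j, i ≠ j → s i j ∈ V) {i j : ι} {S : Finset ι} (hij : i ≠ j) (hi : i ∉ S)
    (hj : j ∉ S) (hLj : 0 ≤ -L (s i j)) (hLS : ∀ k ∈ S, 0 ≤ -L (s i k)) :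
    ∑ k ∈ S, -L (s i k) ≤ moeBound (-L (s i j)) := by
  classical
  have hsum := hs.sum_neg_map_le_one hL hsV (i := i) (S := insert j S)
    (by simp only [Finset.mem_insert, hij, hi, or_self, not_false_eq_true])
  rw [Finset.sum_insert hj] at hsum
  rcases le_or_gt (-L (s i j)) (1 / 2) with hle | hlt
  · rw [moeBound, if_pos hle]
    linarith
  rcases S.eq_empty_or_nonempty with rfl | hS
  · exact moeBound_nonneg hLj
  · have hy := Finset.sum_nonneg hLS
    exact le_moeBound hlt hy (hs.sq_add_mul_add_sq_le hL hsV hij hi hj hS (neg_neg _).symm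
      (by rw [Finset.sum_neg_distrib, neg_neg]) hlt.le hy hsum)

theorem sum_max_neg_map_le_moeBound (hs : IsSwapFamily s) (hL : IsPseudoState V L)
    (hsV : ∀ i j, i ≠ j → s i j ∈ V) {i j : ι} {S : Finset ι} (hij : i ≠ j) (hi : i ∉ S)
    (hj : j ∉ S) :
    ∑ k ∈ S, max (-L (s i k)) 0 ≤ moeBound (max (-L (s i j)) 0) := by
  have hfilter : ∑ k ∈ S, max (-L (s i k)) 0 = ∑ k ∈ S with 0 ≤ -L (s i k), -L (s i k) := by
    simp only [Finset.sum_filter, max_comm _ (0 : ℝ), max_def]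
  have hiT : i ∉ S.filter fun k => 0 ≤ -L (s i k) := fun h => hi (Finset.mem_filter.1 h).1
  have hjT : j ∉ S.filter fun k => 0 ≤ -L (s i k) := fun h => hj (Finset.mem_filter.1 h).1
  rw [hfilter]
  rcases le_total 0 (-L (s i j)) with hpos | hneg
  · rw [max_eq_left hpos]
    exact hs.sum_neg_map_le_moeBound hL hsV hij hiT hjT hpos fun k hk => (Finset.mem_filter.1 hk).2
  · rw [max_eq_right hneg, moeBound, if_pos (by norm_num), sub_zero]
    exact hs.sum_neg_map_le_one hL hsV hiT

end IsSwapFamily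

end SwapFamily

section Heisenberg

variable {R : Type*} [Ring R]

/-- The Heisenberg interaction `X ⊗ X + Y ⊗ Y + Z ⊗ Z` of two Pauli triples. -/
def heisenberg (a b : Fin 3 → R) : R :=
  ∑ m, a m * b m

theorem sum_sum_fin_three_eq {M : Type*} [AddCommMonoid M] (f : Fin 3 → Fin 3 → M) :
    ∑ m, ∑ n, f m n = ∑ m, (f m m + f m (m + 1) + f (m + 1) m) := by
  simp only [Fin.sum_univ_three, Fin.isValue, zero_add, Fin.reduceAdd]
  abel

theorem heisenberg_comm {a b : Fin 3 → R} (hab : ∀ m n, Commute (a m) (b n)) :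
    heisenberg a b = heisenberg b a :=
  Finset.sum_congr rfl fun m _ => (hab m m).eq

section PauliSwap

variable [Algebra ℝ R] {a b c : Fin 3 → R}

/-- The interaction `(1 + X ⊗ X + Y ⊗ Y + Z ⊗ Z) / 2` of two Pauli triples, which for the Pauli
matrices of two qubits is the transposition of the tensor factors. -/
noncomputable def pauliSwap (a b : Fin 3 → R) : R :=
  (1 / 2 : ℝ) • (1 + heisenberg a b)

theorem pauliSwap_mul_self
    (h : heisenberg a b * heisenberg a b = 3 • 1 - 2 • heisenberg a b) :
    pauliSwap a b * pauliSwap a b = 1 := by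
  simp only [pauliSwap, smul_mul_assoc, mul_smul_comm, add_mul, mul_add, one_mul, mul_one, h]
  module

theorem pauliSwap_anticomm
    (h : heisenberg a b * heisenberg a c + heisenberg a c * heisenberg a b =
      2 • heisenberg b c) :
    pauliSwap a b * pauliSwap a c + pauliSwap a c * pauliSwap a b =
      pauliSwap a b + pauliSwap a c + pauliSwap b c - 1 := by
  simp only [pauliSwap, smul_mul_assoc, mul_smul_comm, add_mul, mul_add, one_mul, mul_one]
  linear_combination (norm := module) (1 / 4 : ℝ) • h

end PauliSwap

variable [Algebra ℂ R]

/-- Three elements of a complex algebra satisfying the relations of the Pauli matrices `X, Y, Z`,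
which are indexed cyclically. -/
structure IsPauliTriple (a : Fin 3 → R) : Prop where
  mul_self : ∀ m, a m * a m = 1
  mul_succ : ∀ m, a m * a (m + 1) = Complex.I • a (m + 2)
  succ_mul : ∀ m, a (m + 1) * a m = -(Complex.I • a (m + 2))

namespace IsPauliTriple

variable {a b c : Fin 3 → R}

theorem anticomm (ha : IsPauliTriple a) (m n : Fin 3) :
    a m * a n + a n * a m = if m = n then 2 else 0 := by
  have hcases : n = m ∨ n = m + 1 ∨ m = n + 1 := by omega
  rcases hcases with rfl | rfl | rfl
  · rw [if_pos rfl, ha.mul_self, one_add_one_eq_two]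
  · rw [if_neg (by omega), ha.mul_succ, ha.succ_mul, add_neg_cancel]
  · rw [if_neg (by omega), ha.mul_succ, ha.succ_mul, neg_add_cancel]

theorem heisenberg_mul_self (ha : IsPauliTriple a) (hb : IsPauliTriple b)
    (hab : ∀ m n, Commute (a m) (b n)) :
    heisenberg a b * heisenberg a b = 3 • 1 - 2 • heisenberg a b := by
  have hmul (m n : Fin 3) : a m * b m * (a n * b n) = a m * a n * (b m * b n) :=
    (hab n m).symm.mul_mul_mul_comm _ _
  have hself (m : Fin 3) : a m * b m * (a m * b m) = 1 := by
    rw [hmul, ha.mul_self, hb.mul_self, one_mul]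
  have hsucc (m : Fin 3) : a m * b m * (a (m + 1) * b (m + 1)) = -(a (m + 2) * b (m + 2)) := by
    rw [hmul, ha.mul_succ, hb.mul_succ, smul_mul_smul_comm, Complex.I_mul_I, neg_one_smul]
  have hpred (m : Fin 3) : a (m + 1) * b (m + 1) * (a m * b m) = -(a (m + 2) * b (m + 2)) := by
    rw [hmul, ha.succ_mul, hb.succ_mul, neg_mul_neg, smul_mul_smul_comm, Complex.I_mul_I,
      neg_one_smul]
  have hshift : ∑ m, a (m + 2) * b (m + 2) = heisenberg a b :=
    Equiv.sum_comp (Equiv.addRight 2) fun m => a m * b m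
  calc heisenberg a b * heisenberg a b
      = ∑ m, ∑ n, a m * b m * (a n * b n) := by rw [heisenberg, Finset.sum_mul_sum]
    _ = ∑ m, (a m * b m * (a m * b m) + a m * b m * (a (m + 1) * b (m + 1)) +
          a (m + 1) * b (m + 1) * (a m * b m)) :=
        sum_sum_fin_three_eq fun m n => a m * b m * (a n * b n)
    _ = 3 • 1 - 2 • heisenberg a b := by
        simp only [hself, hsucc, hpred, Finset.sum_add_distrib, Finset.sum_neg_distrib, hshift,
          Finset.sum_const, Finset.card_univ, Fintype.card_fin, nsmul_one, Nat.cast_ofNat]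
        noncomm_ring

theorem heisenberg_anticomm (ha : IsPauliTriple a) (hab : ∀ m n, Commute (a m) (b n))
    (hac : ∀ m n, Commute (a m) (c n)) (hbc : ∀ m n, Commute (b m) (c n)) :
    heisenberg a b * heisenberg a c + heisenberg a c * heisenberg a b = 2 • heisenberg b c := by
  have hleft (m n : Fin 3) : a m * b m * (a n * c n) = a m * a n * (b m * c n) :=
    (hab n m).symm.mul_mul_mul_comm _ _
  have hright (m n : Fin 3) : a n * c n * (a m * b m) = a n * a m * (b m * c n) := by
    rw [(hac m n).symm.mul_mul_mul_comm, (hbc m n).eq]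
  calc heisenberg a b * heisenberg a c + heisenberg a c * heisenberg a b
      = ∑ m, ∑ n, (a m * b m * (a n * c n) + a n * c n * (a m * b m)) := by
        simp only [heisenberg, Finset.sum_mul_sum, Finset.sum_add_distrib]
        rw [Finset.sum_comm (f := fun m n => a m * c m * (a n * b n))]
    _ = ∑ m, ∑ n, (if m = n then 2 else 0) * (b m * c n) := by
        simp only [hleft, hright, ← add_mul, ha.anticomm]
    _ = 2 • heisenberg b c := by
        simp only [ite_mul, zero_mul, Finset.sum_ite_eq, Finset.mem_univ, if_true, heisenberg,
          two_mul, two_nsmul, Finset.sum_add_distrib]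

theorem neg_zero_neg_two (ha : IsPauliTriple a) : IsPauliTriple ![-a 0, a 1, -a 2] where
  mul_self m := by
    fin_cases m <;> simp [ha.mul_self]
  mul_succ m := by
    fin_cases m
    · simpa using ha.mul_succ 0
    · simpa using ha.mul_succ 1
    · simpa using ha.mul_succ 2
  succ_mul m := by
    fin_cases m
    · simpa [neg_eq_iff_eq_neg] using ha.succ_mul 0
    · simpa [neg_eq_iff_eq_neg] using ha.succ_mul 1
    · simpa using ha.succ_mul 2

end IsPauliTriple

variable [Algebra ℝ R]

theorem isSwapFamily_pauliSwap {ι : Type*} {τ : ι → Fin 3 → R} (hτ : ∀ k, IsPauliTriple (τ k))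
    (hcomm : ∀ k l, k ≠ l → ∀ m n, Commute (τ k m) (τ l n)) :
    IsSwapFamily fun k l => pauliSwap (τ k) (τ l) where
  symm k l := by
    obtain rfl | hkl := eq_or_ne k l
    · rfl
    · rw [pauliSwap, pauliSwap, heisenberg_comm (hcomm k l hkl)]
  mul_self k l hkl :=
    pauliSwap_mul_self ((hτ k).heisenberg_mul_self (hτ l) (hcomm k l hkl))
  anticomm j k l hjk hjl hkl :=
    pauliSwap_anticomm
      ((hτ j).heisenberg_anticomm (hcomm j k hjk) (hcomm j l hjl) (hcomm k l hkl))

end Heisenberg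

section Qubits

variable {n : ℕ}

theorem siteOp_mul_siteOp_self (σ τ : PauliLabel) (i : Fin n) :
    siteOp σ i * siteOp τ i = labelPhase σ τ • siteOp (labelMul σ τ) i := by
  have hlabel : (fun l => labelMul (Function.update (fun _ => PauliLabel.I) i σ l)
      (Function.update (fun _ => PauliLabel.I) i τ l)) =
      Function.update (fun _ => PauliLabel.I) i (labelMul σ τ) := by
    ext l
    obtain rfl | hl := eq_or_ne l i
    · simp only [Function.update_self]
    · simp only [Function.update_of_ne hl, labelMul]
  rw [siteOp, siteOp, pauliOp_mul, hlabel, siteOp, Fintype.prod_eq_single i, Function.update_self,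
    Function.update_self]
  intro l hl
  rw [Function.update_of_ne hl, Function.update_of_ne hl, labelPhase_self]

theorem commute_siteOp (σ τ : PauliLabel) {i j : Fin n} (hij : i ≠ j) :
    Commute (siteOp σ i) (siteOp τ j) := by
  rw [Commute, SemiconjBy, siteOp, siteOp, pauliOp_mul, pauliOp_mul]
  simp only [labelMul_comm]
  congr 1
  refine Finset.prod_congr rfl fun l _ => ?_
  obtain rfl | hl := eq_or_ne l i
  · rw [Function.update_of_ne hij, labelPhase_I_left, labelPhase_I_right]
  · rw [Function.update_of_ne hl, labelPhase_I_left, labelPhase_I_right]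

theorem pauliOp_I (n : ℕ) : pauliOp (fun _ : Fin n => PauliLabel.I) = 1 := by
  have hone : pauliMatrix .I = 1 := Matrix.one_fin_two.symm
  ext a b
  simp only [pauliOp, Matrix.of_apply, hone, Matrix.one_apply, Fintype.prod_ite_zero,
    Finset.prod_const_one, funext_iff]

theorem siteOp_I (i : Fin n) : siteOp .I i = (1 : QubitOp n) := by
  rw [siteOp, Function.update_eq_self, pauliOp_I]

/-- The Pauli triple of qubit `k`, twisted by conjugation with `Y` at the qubit `i`. The swap of the
twisted triples of `i` and of another qubit `k` is `1 - h_ik`, and the twist preserves the relations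
between swaps. -/
noncomputable def eprTriple (i k : Fin n) : Fin 3 → QubitOp n :=
  if k = i then ![-siteOp .X k, siteOp .Y k, -siteOp .Z k]
  else ![siteOp .X k, siteOp .Y k, siteOp .Z k]

theorem isPauliTriple_siteOp (k : Fin n) :
    IsPauliTriple ![siteOp .X k, siteOp .Y k, siteOp .Z k] where
  mul_self m := by
    fin_cases m <;> simp [siteOp_mul_siteOp_self, labelMul, labelPhase, siteOp_I]
  mul_succ m := by
    fin_cases m <;> simp [siteOp_mul_siteOp_self, labelMul, labelPhase]
  succ_mul m := by
    fin_cases m <;> simp [siteOp_mul_siteOp_self, labelMul, labelPhase]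

theorem isPauliTriple_eprTriple (i k : Fin n) : IsPauliTriple (eprTriple i k) := by
  unfold eprTriple
  split_ifs
  · exact (isPauliTriple_siteOp k).neg_zero_neg_two
  · exact isPauliTriple_siteOp k

theorem commute_eprTriple (i : Fin n) {k l : Fin n} (hkl : k ≠ l) (p q : Fin 3) :
    Commute (eprTriple i k p) (eprTriple i l q) := by
  unfold eprTriple
  split_ifs <;> fin_cases p <;> fin_cases q <;> simp [commute_siteOp _ _ hkl]

theorem isSwapFamily_eprTriple (i : Fin n) :
    IsSwapFamily fun k l => pauliSwap (eprTriple i k) (eprTriple i l) :=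
  isSwapFamily_pauliSwap (isPauliTriple_eprTriple i) fun _ _ => commute_eprTriple i

theorem pauliSwap_eprTriple_mem {m : ℕ} (hm : 2 ≤ m) (i k l : Fin n) :
    pauliSwap (eprTriple i k) (eprTriple i l) ∈ pauliSpan n m := by
  refine Submodule.smul_mem _ _ (add_mem (one_mem_pauliSpan n m) (sum_mem fun p _ => ?_))
  unfold eprTriple
  split_ifs <;> fin_cases p <;> simp [siteOp_mul_mem hm]

theorem pauliSwap_eprTriple_self {i l : Fin n} (hil : i ≠ l) :
    pauliSwap (eprTriple i i) (eprTriple i l) = 1 - eprTerm i l := by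
  rw [pauliSwap, heisenberg, Fin.sum_univ_three, eprTriple, eprTriple, if_pos rfl,
    if_neg hil.symm, eprTerm]
  simp only [Matrix.cons_val, neg_mul]
  module

end Qubits

section PseudoExpectation

variable {n k : ℕ}

theorem pauliOp_mul_mem_pauliSpan (A B : PauliMonomial n k)
    (h : (pauliOp A.1 * pauliOp B.1).IsHermitian) :
    pauliOp A.1 * pauliOp B.1 ∈ pauliSpan n (2 * k) := by
  have hP := pauliOp_mem_pauliSpan _
    ((pauliWeight_labelMul_le A.1 B.1).trans (by linarith [A.2, B.2]) : _ ≤ 2 * k)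
  rw [Matrix.IsHermitian, pauliOp_mul, Matrix.conjTranspose_smul, (pauliOp_isHermitian _).eq] at h
  obtain ⟨r, hr⟩ := Complex.conj_eq_iff_real.1 (smul_left_injective ℂ (pauliOp_ne_zero _) h)
  rw [pauliOp_mul, hr, Complex.coe_smul]
  exact Submodule.smul_mem _ r hP

theorem star_prod_labelPhase (s t : PauliString n) :
    star (∏ i, labelPhase (s i) (t i)) = ∏ i, labelPhase (s i) (t i) ∨
      star (∏ i, labelPhase (s i) (t i)) = -∏ i, labelPhase (s i) (t i) := by
  refine Finset.prod_induction _ (fun c : ℂ => star c = c ∨ star c = -c) ?_ (Or.inl (star_one ℂ)) ?_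
  · rintro c d (hc | hc) (hd | hd) <;> simp [hc, hd]
  · intro i _
    cases s i <;> cases t i <;> simp [labelPhase]

theorem star_pauliOp_mul (s t : PauliString n) :
    star (pauliOp s * pauliOp t) = pauliOp s * pauliOp t ∨
      star (pauliOp s * pauliOp t) = -(pauliOp s * pauliOp t) := by
  rw [pauliOp_mul, star_smul, Matrix.star_eq_conjTranspose, (pauliOp_isHermitian _).eq]
  rcases star_prod_labelPhase s t with h | h
  · exact Or.inl (by rw [h])
  · exact Or.inr (by rw [h, neg_smul])

/-- Composing with the self-adjoint part kills the products of anticommuting Pauli strings, on which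
a moment matrix vanishes as well. -/
theorem exists_extend_pseudoExpectation (Γ : MomentMatrix n k) :
    ∃ L : QubitOp n →ₗ[ℝ] ℝ,
      (∀ C (h : C ∈ pauliSpan n (2 * k)), L C = pseudoExpectation Γ ⟨C, h⟩) ∧
      ∀ A B : PauliMonomial n k, L (pauliOp A.1 * pauliOp B.1) = Γ.1 A B := by
  obtain ⟨L, hL⟩ := LinearMap.exists_extend (pseudoExpectation Γ)
  let L' : QubitOp n →ₗ[ℝ] ℝ :=
    L ∘ₗ (selfAdjoint.submodule ℝ (QubitOp n)).subtype ∘ₗ selfAdjointPart ℝ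
  have hL' (C : QubitOp n) (h : C ∈ pauliSpan n (2 * k)) : L' C = pseudoExpectation Γ ⟨C, h⟩ := by
    have hC : IsSelfAdjoint C := isHermitian_of_mem_pauliSpan h
    calc L' C = L C := congrArg L (hC.coe_selfAdjointPart_apply ℝ)
      _ = pseudoExpectation Γ ⟨C, h⟩ := LinearMap.congr_fun hL ⟨C, h⟩
  refine ⟨L', hL', fun A B => ?_⟩
  by_cases hherm : (pauliOp A.1 * pauliOp B.1).IsHermitian
  · rw [hL' _ (pauliOp_mul_mem_pauliSpan A B hherm), pseudoExpectation_mul]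
  · have hneg := (star_pauliOp_mul A.1 B.1).resolve_left hherm
    have hpart : (selfAdjointPart ℝ (pauliOp A.1 * pauliOp B.1) : QubitOp n) = 0 := by
      rw [selfAdjointPart_apply_coe, hneg, add_neg_cancel, smul_zero]
    rw [Γ.2.eq_zero_of_not_isHermitian A B hherm]
    exact (congrArg L hpart).trans (map_zero L)

theorem isPseudoState_of_map_pauliOp_mul (Γ : MomentMatrix n k) {L : QubitOp n →ₗ[ℝ] ℝ}
    (hL : ∀ A B : PauliMonomial n k, L (pauliOp A.1 * pauliOp B.1) = Γ.1 A B) :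
    IsPseudoState (pauliSpan n k) L where
  one_mem := one_mem_pauliSpan n k
  map_one := by
    let one : PauliMonomial n k := ⟨fun _ => .I, by simp [pauliWeight]⟩
    have h := (hL one one).trans (Γ.2.diag_eq_one one)
    rwa [pauliOp_I, one_mul] at h
  map_mul_self_nonneg M hM := by
    obtain ⟨c, rfl⟩ := (Submodule.mem_span_range_iff_exists_fun ℝ).1 hM
    have hquad : L ((∑ A, c A • pauliOp A.1) * ∑ A, c A • pauliOp A.1) =
        star c ⬝ᵥ Γ.1.mulVec c := by
      rw [Finset.sum_mul_sum]
      simp only [smul_mul_smul_comm, map_sum, map_smul, hL, smul_eq_mul,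
        dotProduct, Matrix.mulVec, Finset.mul_sum, star_trivial]
      exact Finset.sum_congr rfl fun A _ => Finset.sum_congr rfl fun B _ => by ring
    rw [hquad]
    exact Γ.2.posSemidef.dotProduct_mulVec_nonneg c

theorem edgeValue_eq_neg_map_pauliSwap (hk : 1 ≤ k) (Γ : MomentMatrix n k)
    {L : QubitOp n →ₗ[ℝ] ℝ}
    (hL : ∀ C (h : C ∈ pauliSpan n (2 * k)), L C = pseudoExpectation Γ ⟨C, h⟩)
    (hone : L 1 = 1) {i l : Fin n} (hil : i ≠ l) :
    edgeValue hk Γ i l = -L (pauliSwap (eprTriple i i) (eprTriple i l)) := by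
  have hcorr (σ : PauliLabel) : pauliCorrelation hk Γ σ i l = L (siteOp σ i * siteOp σ l) :=
    (hL _ _).symm
  rw [pauliSwap_eprTriple_self hil, eprTerm, edgeValue, hcorr, hcorr, hcorr]
  simp only [map_sub, map_smul, map_add, hone, smul_eq_mul]
  ring

end PseudoExpectation

theorem mainTheorem3_general {n k : ℕ} (hk : 2 ≤ k) (Γ : MomentMatrix n k) {i j : Fin n}
    {S : Finset (Fin n)} (hij : i ≠ j) (hi : i ∉ S) (hj : j ∉ S) :
    ∑ l ∈ S, edgeValuePos (one_le_two.trans hk) Γ i l ≤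
      moeBound (edgeValuePos (one_le_two.trans hk) Γ i j) := by
  obtain ⟨L, hLΓ, hLmul⟩ := exists_extend_pseudoExpectation Γ
  have hL := isPseudoState_of_map_pauliOp_mul Γ hLmul
  have hval {l : Fin n} (hil : i ≠ l) : edgeValuePos (one_le_two.trans hk) Γ i l =
      max (-L (pauliSwap (eprTriple i i) (eprTriple i l))) 0 := by
    rw [edgeValuePos, edgeValue_eq_neg_map_pauliSwap _ Γ hLΓ hL.map_one hil]
  rw [hval hij, Finset.sum_congr rfl fun l hl => hval (ne_of_mem_of_not_mem hl hi).symm]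
  exact (isSwapFamily_eprTriple i).sum_max_neg_map_le_moeBound hL
    (fun k l _ => pauliSwap_eprTriple_mem hk i k l) hij hi hj

theorem mainTheorem3 (n : ℕ) (G : SimpleGraph (Fin n)) [DecidableRel G.Adj]
    (w : G.edgeSet → ℝ) (hw : ∀ e, 0 < w e)
    (Γ : MomentMatrix n 2) (hΓ : IsSDPOutput one_le_two G w Γ)
    (i j : Fin n) (hij : G.Adj i j) :
    ∑ l ∈ G.neighborFinset i \ {j}, edgeValuePos one_le_two Γ i l
      ≤ moeBound (edgeValuePos one_le_two Γ i j) :=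
  mainTheorem3_general le_rfl Γ hij.ne (by simp) (by simp)
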